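/- Let $(V,\mathscr F,\mu)$ be a $\sigma$-finite measure space and let $K$ be a complex kernel on $V$: $K_x=K(x,\cdot)$ is a complex measure for every $x\in V$, and $x\mapsto K(x,B)$ is measurable for every $B\in\mathscr F$. Assume that $K$ is $(1,\infty)$-bounded, i.e. $K(x,B)=\int_B h(x,y)\,\mu(dy)$ for all $x\in V$, $B\in\mathscr F$, with a measurable $h:V\times V\to\mathbb C$ such that $\sup_{y}\int_V|h(x,y)|\,\mu(dx)<\infty$. Let $d:V\to\mathbb C$ be bounded and measurable, and let $A$ be the operator on $L^1(V)=L^1(V,\mu)$, $$(Af)(x)=d(x)f(x)+\int_V f(y)\,K(x,dy).$$ Let $S\in\mathscr F$ be a structural set of type B for $K$: $S\neq\emptyset$, and, with $S^c=V\setminus S$, $\operatorname{supp}(K_x)$ a set on which $K_x$ is concentrated ($|K_x|(V\setminus \operatorname{supp}(K_x))=0$), $\varphi(x)=S^c\cap\operatorname{supp}(K_x)$, and $\varphi^0(x)=\{x\}$, $\varphi^n(x)=\bigcup_{y\in\varphi^{n-1}(x)}\varphi(y)$, there is a measurable $M:S^c\to[0,\infty)$ such that (i) for every $x\in S^c$ there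 is $n$ with $\varphi^n(x)=\emptyset$, and $n_S(x)$ denotes the least such $n$; (ii) $|K(x,B)|\le M(x)\mu(B)$ for all $x\in S^c$ and measurable $B\subseteq S^c$; (iii) $\int_{S^c}n_S(x)M(x)\,\mu(dx)<\infty$. Put $\Sigma_d=\overline{d(V\setminus S)}$ and $L^1(S)=L^1(S,\mu|_S)$. For $\lambda\in\mathbb C\setminus\Sigma_d$ define $R_S(\lambda)$ on $L^1(S)$ by $$(R_S(\lambda)f)(x)=d(x)f(x)+\sum_{n\ge1}\int_S f(y)\,K^{(n)}_{S,\lambda}(x,dy),$$ where $\int_S f\,dK^{(1)}_{S,\lambda}(x,\cdot)=\int_S f(y)K(x,dy)$ and, for $n\ge2$, $\int_S f(y)\,K^{(n)}_{S,\lambda}(x,dy)$ is the iterated integral $$\int_{S^c}\!\cdots\!\int_{S^c}\int_S \frac{f(y)\,K(x,dz_1)K(z_1,dz_2)\cdots K(z_{n-1},dy)}{\prod_{p=1}^{n-1}(\lambda-d(z_p))}.$$ Let $\mathrm{sp}(R_S)$ be the set of $\lambda\in\mathbb C\setminus\Sigma_d$ for which $R_S(\lambda)-\lambda I$ is not invertible,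 and let $S_0=S$, $S_n=\{x\in V:|K|(x,V\setminus S_{n-1})=0\}\cup S_{n-1}$ for $n\ge 1$. Then $A$ is a well-defined bounded operator on $L^1(V)$, for every $\lambda\in\mathbb C\setminus\Sigma_d$ $R_S(\lambda)$ is a well-defined bounded operator on $L^1(S)$ (for every $f$ the integrals and the series above converge absolutely for almost every $x$), and: 1. $\mathrm{sp}(A)\setminus\Sigma_d\subseteq \mathrm{sp}(R_S)$. 2. For $\lambda_0\in\mathbb C\setminus\Sigma_d$, $\lambda_0$ is an eigenvalue of $A$ if and only if $\lambda_0$ is an eigenvalue of $R_S(\lambda_0)$. 3. If $\lambda_0\in\mathbb C\setminus\Sigma_d$ and $u\in L^1(V)$ is an eigenfunction of $A$ for $\lambda_0$, then the restriction of $u$ to $S$ is an eigenfunction of $R_S(\lambda_0)$ for $\lambda_0$. 4. If $\lambda_0\in\mathbb C\setminus\Sigma_d$ and $v\in L^1(S)$ is an eigenfunction of $R_S(\lambda_0)$ for $\lambda_0$, then the relations (understood almost everywhere) $$u(x)=v(x)\ \ (x\in S),\qquad u(z)=\int_{S_{n-1}}\frac{K(z,dy)}{\lambda_0-d(z)}\,u(y)\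 \ (z\in S_n\setminus S_{n-1},\ n\ge1)$$ have a solution $u\in L^1(V)$ which is an eigenfunction of $A$ for $\lambda_0$, and every function on $V$ satisfying them is almost everywhere equal to $u$. -/

import Mathlib

open MeasureTheory
open scoped ENNReal NNReal

noncomputable section

namespace IsospectralReduction

variable {V : Type*} [MeasurableSpace V]

/-! ### Complex kernels -/

/-- A kernel on `V`: a complex measure `K_x = K(x, ·)` for every `x`, such that `x ↦ K(x, B)` is
measurable for every measurable set `B`. -/
structure ComplexKernel (V : Type*) [MeasurableSpace V] where
  meas : V → ComplexMeasure V
  measurable_apply : ∀ B : Set V, MeasurableSet B → Measurable fun x => meas x B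

/-- The integral `∫_s f dκ` of a complex function against a complex measure (the value is `0` when
`f` is not integrable on `s` with respect to the total variation of `κ`). -/
def cintegral (κ : ComplexMeasure V) (s : Set V) (f : V → ℂ) : ℂ :=
  ∫ᵛ y in s, f y ∂[ContinuousLinearMap.mul ℝ ℂ; κ]

/-- `K` is `(1,∞)`-bounded: `K(x, B) = ∫_B h(x, y) μ(dy)` for a jointly measurable density `h` with
`sup_y ∫ |h(x, y)| μ(dx) < ∞`. -/
def ComplexKernel.IsOneInftyBounded (K : ComplexKernel V) (μ : Measure V) : Prop :=
  ∃ h : V → V → ℂ, Measurable (Function.uncurry h) ∧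
    (∃ C : ℝ≥0, ∀ y, ∫⁻ x, ‖h x y‖ₑ ∂μ ≤ C) ∧
    ∀ x, Integrable (h x) μ ∧
      ∀ B : Set V, MeasurableSet B → K.meas x B = ∫ y in B, h x y ∂μ

/-! ### Structural sets of type B -/

/-- The iterates of a point-set map: `F⁰(x) = {x}` and `Fⁿ⁺¹(x) = ⋃ {F(y) : y ∈ Fⁿ(x)}`. -/
def setIter (F : V → Set V) : ℕ → V → Set V
  | 0, x => {x}
  | n + 1, x => ⋃ y ∈ setIter F n x, F y

/-- The point-set map `x ↦ Sᶜ ∩ supp(K_x)`. -/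
def phi (supp : V → Set V) (S : Set V) (x : V) : Set V := Sᶜ ∩ supp x

/-- `n_S(x)`, the least `k` such that the `k`-th iterate of `phi` at `x` is empty. -/
def exitTime (supp : V → Set V) (S : Set V) (x : V) : ℕ :=
  sInf {k : ℕ | setIter (phi supp S) k x = ∅}

/-- `S` is a structural set of type B for `K`. No topology is given on `V`, so a support of `K_x` is
a set on which the complex measure `K_x` is concentrated, e.g. `{y | h x y ≠ 0}` for a density `h`.
The function `M`, given on `Sᶜ`, is extended to `V`; its values on `S` are not used. -/
def IsStructuralB (K : ComplexKernel V) (μ : Measure V) (S : Set V) : Prop :=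
  S.Nonempty ∧
  ∃ supp : V → Set V, (∀ x, (K.meas x).variation (supp x)ᶜ = 0) ∧
  ∃ M : V → ℝ≥0, Measurable M ∧
    (∀ x ∈ Sᶜ, ∃ n : ℕ, setIter (phi supp S) n x = ∅) ∧
    (∀ x ∈ Sᶜ, ∀ B : Set V, MeasurableSet B → B ⊆ Sᶜ → ‖K.meas x B‖ₑ ≤ M x * μ B) ∧
    ∫⁻ x in Sᶜ, (exitTime supp S x : ℝ≥0∞) * M x ∂μ < ∞

/-! ### Operators on `L¹` -/

/-- `T` is the bounded operator on `L¹(ν)` given by the formula `F`, i.e. `(T f)(x) = (F f)(x)`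
for almost every `x`. -/
def Represents (ν : Measure V) (F : (V → ℂ) → V → ℂ)
    (T : Lp ℂ 1 ν →L[ℂ] Lp ℂ 1 ν) : Prop :=
  ∀ f : Lp ℂ 1 ν, T f =ᵐ[ν] F f

theorem Represents.unique {ν : Measure V} {F : (V → ℂ) → V → ℂ}
    {T T' : Lp ℂ 1 ν →L[ℂ] Lp ℂ 1 ν} (h : Represents ν F T) (h' : Represents ν F T') :
    T = T' :=
  ContinuousLinearMap.ext fun f => Lp.ext ((h f).trans (h' f).symm)

open Classical in
/-- The bounded operator on `L¹(ν)` given by the formula `F` (and `0` if there is none). -/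
def operatorOf (ν : Measure V) (F : (V → ℂ) → V → ℂ) : Lp ℂ 1 ν →L[ℂ] Lp ℂ 1 ν :=
  if h : ∃ T, Represents ν F T then h.choose else 0

/-- The formula `d(x) f(x) + ∫_V f(y) K(x, dy)`. -/
def formulaA (K : ComplexKernel V) (d : V → ℂ) (f : V → ℂ) (x : V) : ℂ :=
  d x * f x + cintegral (K.meas x) Set.univ f

/-- The operator `A = d + Q_K` on `L¹(V, μ)`. -/
def opA (K : ComplexKernel V) (d : V → ℂ) (μ : Measure V) : Lp ℂ 1 μ →L[ℂ] Lp ℂ 1 μ :=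
  operatorOf μ (formulaA K d)

/-- `Σ_d`, the closure of `d(V ∖ S)`. -/
def sigmaD (d : V → ℂ) (S : Set V) : Set ℂ := closure (d '' Sᶜ)

/-- `reducedKernel K d S lam n x B` is `K_{S,lam}^{(n+1)}(x, B)`, that is, `K(x, B)` for `n = 0` and
`∫_{Sᶜ} ⋯ ∫_{Sᶜ} K(x, dz₁) K(z₁, dz₂) ⋯ K(zₙ, B) / ∏ₚ (lam - d(zₚ))` otherwise. -/
def reducedKernel (K : ComplexKernel V) (d : V → ℂ) (S : Set V) (lam : ℂ) :
    ℕ → V → Set V → ℂ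
  | 0, x, B => K.meas x B
  | n + 1, x, B =>
      cintegral (K.meas x) Sᶜ fun z => reducedKernel K d S lam n z B / (lam - d z)

/-- `reducedTerm K d S lam f n x` is the iterated integral `∫_S f(y) K_{S,lam}^{(n+1)}(x, dy)`,
that is, `∫_S f(y) K(x, dy)` for `n = 0` and
`∫_{Sᶜ} ⋯ ∫_{Sᶜ} ∫_S f(y) K(x, dz₁) K(z₁, dz₂) ⋯ K(zₙ, dy) / ∏ₚ (lam - d(zₚ))` otherwise. -/
def reducedTerm (K : ComplexKernel V) (d : V → ℂ) (S : Set V) (lam : ℂ) (f : V → ℂ) :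
    ℕ → V → ℂ
  | 0, x => cintegral (K.meas x) S f
  | n + 1, x => cintegral (K.meas x) Sᶜ fun z => reducedTerm K d S lam f n z / (lam - d z)

/-- Integrating the indicator of `B` against `K_{S,lam}^{(n+1)}(x, ·)` gives its value on `B`. -/
theorem reducedTerm_indicator (K : ComplexKernel V) {μ : Measure V}
    (hK : K.IsOneInftyBounded μ) (d : V → ℂ) (S : Set V) (lam : ℂ)
    (hS : MeasurableSet S) (B : Set V) (hB : MeasurableSet B) (hBS : B ⊆ S) (n : ℕ) (x : V) :
    reducedTerm K d S lam (B.indicator fun _ => 1) n x = reducedKernel K d S lam n x B := by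
  induction n generalizing x with
  | zero =>
    obtain ⟨h, -, -, hh⟩ := hK
    have hx : K.meas x = μ.withDensityᵥ (h x) :=
      VectorMeasure.ext fun B hB => by rw [(hh x).2 B hB, withDensityᵥ_apply (hh x).1 hB]
    have hfin : IsFiniteMeasure (K.meas x).variation := by
      rw [hx, Measure.variation_withDensityᵥ (hh x).1]
      exact isFiniteMeasure_withDensity (hh x).1.2.ne
    simp only [reducedTerm, reducedKernel, cintegral]
    rw [VectorMeasure.integral_indicator_const _ hB]
    simp [VectorMeasure.restrict_apply, hS, hB, Set.inter_eq_left.2 hBS]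
  | succ n ih =>
    simp only [reducedTerm, reducedKernel, ih]

/-- The formula `d(x) f(x) + ∫_S f(y) R_{S,lam}(x, dy)`, where `R_{S,lam}` is the sum of the kernels
`K_{S,lam}^{(n)}` over `n ≥ 1`. -/
def formulaR (K : ComplexKernel V) (d : V → ℂ) (S : Set V) (lam : ℂ) (f : V → ℂ) (x : V) : ℂ :=
  d x * f x + ∑' n : ℕ, reducedTerm K d S lam f n x

/-- The reduced operator `R_S(lam)` on `L¹(S)`. -/
def reducedOp (K : ComplexKernel V) (d : V → ℂ) (μ : Measure V) (S : Set V) (lam : ℂ) :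
    Lp ℂ 1 (μ.restrict S) →L[ℂ] Lp ℂ 1 (μ.restrict S) :=
  operatorOf (μ.restrict S) (formulaR K d S lam)

/-- The spectrum of the family `R_S`: the `lam ∉ Σ_d` for which `R_S(lam) - lam I` is not
invertible. -/
def spReduced (K : ComplexKernel V) (d : V → ℂ) (μ : Measure V) (S : Set V) : Set ℂ :=
  {lam | lam ∉ sigmaD d S ∧
    ¬ IsUnit (reducedOp K d μ S lam -
      lam • (1 : Lp ℂ 1 (μ.restrict S) →L[ℂ] Lp ℂ 1 (μ.restrict S)))}

/-! ### Depth recursion -/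

/-- The set `S_n` of points of depth at most `n`: `S_0 = S` and
`S_{n+1} = {x | |K|(x, V ∖ S_n) = 0} ∪ S_n`. -/
def depthSet (K : ComplexKernel V) (S : Set V) : ℕ → Set V
  | 0 => S
  | n + 1 => {x | (K.meas x).variation (depthSet K S n)ᶜ = 0} ∪ depthSet K S n

/-- `u` satisfies the depth recursion with initial value `v`: `u = v` on `S` and
`u(z) = ∫_{S_n} K(z, dy) / (lam - d(z)) u(y)` on `S_{n+1} ∖ S_n` for all `n`, almost everywhere. -/
def DepthRecursion (K : ComplexKernel V) (d : V → ℂ) (μ : Measure V) (S : Set V) (lam : ℂ)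
    (v u : V → ℂ) : Prop :=
  (∀ᵐ x ∂μ, x ∈ S → u x = v x) ∧
  ∀ n : ℕ, ∀ᵐ z ∂μ, z ∈ depthSet K S (n + 1) \ depthSet K S n →
    u z = cintegral (K.meas z) (depthSet K S n) fun y => u y / (lam - d z)

end IsospectralReduction

end

open IsospectralReduction

/-! The argument is a Schur complement. On `L¹(V)` write `A = D + H`, with `D` multiplication by `d`
and `H` the integral operator with density `h`. Let `ρ` be restriction to `S`, `ι` extension by
zero, and `Q = 1 - ι ρ`. Off `Σ_d` multiplication by `1 / (lam - d)` on `Sᶜ`, zero on `S`, is a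
bounded operator `L`. If `1 - L H Q` has a bounded inverse `G`, then `lam u - A u = g` determines
the part of `u` on `Sᶜ` from `ρ u` and `g`, and what remains is `(lam - R) ρ u = ρ (g + H G L g)`
with `R = ρ (D + H + H G L H) ι` (`schur_iff`). Taking `g = 0` transfers eigenvectors, arbitrary `g`
transfers invertibility.

The analytic core is the existence of `G`. The norm of `N = L H Q` need not be small, so smallness
is replaced by depth: at a point of `S_{k+1} ∖ S_k` the kernel only sees `S_k`. There `∑ |Nⁿ f|` is
at most `|f|` plus a multiple of `M` times its integral over `S_k`. A Gronwall induction along the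
depth sets (`lintegral_le_exp_mul_of_levels`) bounds `∑ ‖Nⁿ f‖` by a constant times `‖f‖`
(`IsDensity.tsum_enorm_pow_ne_top`), so the Neumann series converges.

Expanding `G` in that series turns `H + H G L H` into the sum of iterated integrals defining
`R_S(lam)` (`reducedTerm_ae`, `represents_formulaR`). The depth recursion is the eigenvalue equation
on `Sᶜ` divided by `lam - d`; its uniqueness is an induction on depth. -/

namespace IsospectralReduction

/-! ### Integrals against a complex measure with a density -/

section Bridge

variable {V : Type*} [MeasurableSpace V] {μ : Measure V}

/-- The two integrands differ by a phase `g / ‖g‖` or its inverse, which is bounded by 1. -/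
theorem integrable_nnnorm_smul_iff {g f : V → ℂ} (hg : AEStronglyMeasurable g μ) :
    Integrable (fun y => ‖g y‖₊ • f y) μ ↔ Integrable (fun y => g y * f y) μ := by
  have hn : AEStronglyMeasurable (fun y => (‖g y‖ : ℂ)) μ :=
    Complex.continuous_ofReal.comp_aestronglyMeasurable hg.norm
  have hb : ∀ z : ℂ, ‖z / (‖z‖ : ℂ)‖ ≤ 1 := fun z => by
    rw [norm_div, Complex.norm_real, norm_norm]; exact div_self_le_one _
  have hb' : ∀ z : ℂ, ‖(‖z‖ : ℂ) / z‖ ≤ 1 := fun z => by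
    rw [norm_div, Complex.norm_real, norm_norm]; exact div_self_le_one _
  constructor <;> intro hi
  · refine (hi.bdd_mul (c := 1) (hg.div₀ hn) (.of_forall fun y => hb _)).congr
      (.of_forall fun y => ?_)
    rcases eq_or_ne (g y) 0 with h0 | h0
    · simp [h0]
    · have : (‖g y‖ : ℂ) ≠ 0 := by simpa using h0
      simp only [Pi.div_apply, NNReal.smul_def, coe_nnnorm, Complex.real_smul]
      field_simp
  · refine (hi.bdd_mul (c := 1) (hn.div₀ hg) (.of_forall fun y => hb' _)).congr
      (.of_forall fun y => ?_)
    rcases eq_or_ne (g y) 0 with h0 | h0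
    · simp [h0]
    · simp only [Pi.div_apply, NNReal.smul_def, coe_nnnorm, Complex.real_smul]
      field_simp

theorem integrable_withDensityᵥ_iff {g f : V → ℂ} (hg : Integrable g μ) :
    (μ.withDensityᵥ g).Integrable f ↔ Integrable (fun y => g y * f y) μ := by
  rw [VectorMeasure.Integrable, Measure.variation_withDensityᵥ hg,
    ← integrable_nnnorm_smul_iff hg.1]
  exact integrable_withDensity_iff_integrable_smul₀ hg.1.aemeasurable.nnnorm

/-- Both sides are additive and continuous in `f` for the `L¹` norm of the variation `|g| μ`, and
agree on indicators. For non-integrable `f` both take the default value 0. -/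
theorem integral_withDensityᵥ {g : V → ℂ} (hg : Integrable g μ) (f : V → ℂ) :
    ∫ᵛ y, f y ∂[ContinuousLinearMap.mul ℝ ℂ; μ.withDensityᵥ g] = ∫ y, g y * f y ∂μ := by
  have hvar := Measure.variation_withDensityᵥ hg
  have : IsFiniteMeasure (μ.withDensityᵥ g).variation := by
    rw [hvar]; exact isFiniteMeasure_withDensity hg.2.ne
  by_cases hf : (μ.withDensityᵥ g).Integrable f
  swap
  · rw [VectorMeasure.integral_undef hf, integral_undef]
    rwa [← integrable_withDensityᵥ_iff hg]
  refine Integrable.induction (P := fun f => ∫ᵛ y, f y ∂[ContinuousLinearMap.mul ℝ ℂ;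
    μ.withDensityᵥ g] = ∫ y, g y * f y ∂μ) ?_ ?_ ?_ ?_ hf
  · intro c s hs _
    rw [VectorMeasure.integral_indicator_const _ hs, withDensityᵥ_apply hg hs]
    simp only [ContinuousLinearMap.mul_apply']
    rw [mul_comm, ← integral_mul_const, ← integral_indicator hs]
    congr 1 with y
    by_cases hy : y ∈ s <;> simp [hy]
  · intro f₁ f₂ _ h₁ h₂ e₁ e₂
    simp only [Pi.add_apply, mul_add]
    rw [VectorMeasure.integral_fun_add h₁ h₂, e₁, e₂,
      integral_add ((integrable_withDensityᵥ_iff hg).1 h₁) ((integrable_withDensityᵥ_iff hg).1 h₂)]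
  · refine isClosed_eq (continuous_setToFun _) ?_
    refine LipschitzWith.continuous (K := 1) (LipschitzWith.of_dist_le_mul fun f₁ f₂ => ?_)
    have i₁ := (integrable_withDensityᵥ_iff hg).1 (L1.integrable_coeFn f₁)
    have i₂ := (integrable_withDensityᵥ_iff hg).1 (L1.integrable_coeFn f₂)
    rw [dist_eq_norm, ← integral_sub i₁ i₂, NNReal.coe_one, one_mul, L1.dist_eq_integral_dist]
    refine (norm_integral_le_integral_norm _).trans (le_of_eq ?_)
    have : ∫ y, dist (f₁ y) (f₂ y) ∂(μ.withDensityᵥ g).variation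
        = ∫ y, dist (f₁ y) (f₂ y) ∂μ.withDensity fun y => (‖g y‖₊ : ℝ≥0∞) := by
      exact congrArg (fun ρ : Measure V => ∫ y, dist (f₁ y) (f₂ y) ∂ρ) hvar
    rw [this, integral_withDensity_eq_integral_smul₀ hg.1.aemeasurable.nnnorm]
    congr 1 with y
    rw [← mul_sub, norm_mul, dist_eq_norm, NNReal.smul_def, coe_nnnorm, smul_eq_mul]
  · intro f₁ f₂ h12 h₁ e₁
    rw [← VectorMeasure.integral_congr_ae h12, e₁]
    have h12' : f₁ =ᵐ[μ.withDensity fun y => ‖g y‖ₑ] f₂ := by rw [← hvar]; exact h12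
    -- Equality almost everywhere for `|g| μ` says nothing where `g = 0`, but there both products
    -- vanish.
    rw [Filter.EventuallyEq, ae_withDensity_iff' hg.1.enorm] at h12'
    refine integral_congr_ae ?_
    filter_upwards [h12'] with y hy
    rcases eq_or_ne (g y) 0 with h0 | h0
    · simp [h0]
    · rw [hy (by simpa using h0)]

theorem withDensityᵥ_restrict {g : V → ℂ} (hg : Integrable g μ) {s : Set V}
    (hs : MeasurableSet s) :
    (μ.withDensityᵥ g).restrict s = (μ.restrict s).withDensityᵥ g := by
  ext t ht
  rw [VectorMeasure.restrict_apply _ hs ht, withDensityᵥ_apply hg (ht.inter hs),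
    withDensityᵥ_apply hg.restrict ht, Measure.restrict_restrict ht]

theorem integrableOn_withDensityᵥ_iff {g f : V → ℂ} (hg : Integrable g μ) {s : Set V}
    (hs : MeasurableSet s) :
    (μ.withDensityᵥ g).IntegrableOn f s ↔ IntegrableOn (fun y => g y * f y) s μ := by
  rw [VectorMeasure.IntegrableOn, withDensityᵥ_restrict hg hs,
    integrable_withDensityᵥ_iff hg.restrict, IntegrableOn]

theorem cintegral_withDensityᵥ {g : V → ℂ} (hg : Integrable g μ) (f : V → ℂ) {s : Set V}
    (hs : MeasurableSet s) :
    cintegral (μ.withDensityᵥ g) s f = ∫ y in s, g y * f y ∂μ := by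
  rw [cintegral, withDensityᵥ_restrict hg hs, integral_withDensityᵥ hg.restrict]

end Bridge

/-! ### Bounded operators on `L¹` from pointwise formulas -/

section Construction

variable {V : Type*} [MeasurableSpace V]

/-- A formula which is additive, homogeneous and bounded on integrable functions defines a bounded
operator between `L¹` spaces. -/
theorem exists_clm_of_formula {μ ν : Measure V} (F : (V → ℂ) → V → ℂ) (C : ℝ≥0)
    (hcongr : ∀ f g, f =ᵐ[μ] g → F f =ᵐ[ν] F g)
    (hadd : ∀ f g, Integrable f μ → Integrable g μ → F (f + g) =ᵐ[ν] F f + F g)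
    (hsmul : ∀ (c : ℂ) (f), Integrable f μ → F (c • f) =ᵐ[ν] c • F f)
    (hmeas : ∀ f, Integrable f μ → AEStronglyMeasurable (F f) ν)
    (hbound : ∀ f, Integrable f μ → ∫⁻ x, ‖F f x‖ₑ ∂ν ≤ C * ∫⁻ x, ‖f x‖ₑ ∂μ) :
    ∃ T : Lp ℂ 1 μ →L[ℂ] Lp ℂ 1 ν, ∀ f : Lp ℂ 1 μ, T f =ᵐ[ν] F f := by
  have hint : ∀ f : Lp ℂ 1 μ, Integrable (F f) ν := fun f =>
    ⟨hmeas _ (L1.integrable_coeFn f), (hbound _ (L1.integrable_coeFn f)).trans_lt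
      (ENNReal.mul_lt_top ENNReal.coe_lt_top (L1.integrable_coeFn f).2)⟩
  let T₀ : Lp ℂ 1 μ →ₗ[ℂ] Lp ℂ 1 ν :=
    { toFun := fun f => (hint f).toL1 _
      map_add' := fun f g => by
        rw [← Integrable.toL1_add, Integrable.toL1_eq_toL1_iff]
        exact (hcongr _ _ (Lp.coeFn_add f g)).trans
          (hadd _ _ (L1.integrable_coeFn f) (L1.integrable_coeFn g))
      map_smul' := fun c f => by
        rw [RingHom.id_apply, ← Integrable.toL1_smul, Integrable.toL1_eq_toL1_iff]
        exact (hcongr _ _ (Lp.coeFn_smul c f)).trans (hsmul c _ (L1.integrable_coeFn f)) }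
  refine ⟨T₀.mkContinuous C fun f => ?_, fun f => (hint f).coeFn_toL1⟩
  have hb := hbound _ (L1.integrable_coeFn f)
  have h1 : ‖T₀ f‖ = (∫⁻ x, ‖F f x‖ₑ ∂ν).toReal := by
    rw [← toReal_enorm]
    exact congrArg _ (Integrable.enorm_toL1 (hint f))
  have h2 : ‖f‖ = (∫⁻ x, ‖f x‖ₑ ∂μ).toReal := by
    rw [L1.norm_def]
  rw [h1, h2, ← ENNReal.coe_toReal, ← ENNReal.toReal_mul]
  exact ENNReal.toReal_mono
    (ENNReal.mul_lt_top ENNReal.coe_lt_top (L1.integrable_coeFn f).2).ne hb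

theorem exists_clm_mul {μ : Measure V} {b : V → ℂ} (hb : Measurable b) (C : ℝ≥0)
    (hC : ∀ x, ‖b x‖ₑ ≤ C) :
    ∃ T : Lp ℂ 1 μ →L[ℂ] Lp ℂ 1 μ, ∀ f : Lp ℂ 1 μ, T f =ᵐ[μ] fun x => b x * f x := by
  refine exists_clm_of_formula (fun f x => b x * f x) C ?_ ?_ ?_ ?_ ?_
  · intro f g h
    filter_upwards [h] with x hx
    rw [hx]
  · exact fun f g _ _ => .of_forall fun x => mul_add _ _ _
  · exact fun c f _ => .of_forall fun x => mul_left_comm _ _ _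
  · exact fun f hf => hb.aestronglyMeasurable.mul hf.1
  · intro f hf
    rw [← lintegral_const_mul' _ _ ENNReal.coe_ne_top]
    refine lintegral_mono fun x => ?_
    rw [enorm_mul]
    gcongr
    exact hC x

theorem exists_clm_extendByZero (μ : Measure V) {S : Set V} (hS : MeasurableSet S) :
    ∃ T : Lp ℂ 1 (μ.restrict S) →L[ℂ] Lp ℂ 1 μ,
      ∀ f : Lp ℂ 1 (μ.restrict S), T f =ᵐ[μ] S.indicator f := by
  refine exists_clm_of_formula (fun f => S.indicator f) 1 ?_ ?_ ?_ ?_ ?_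
  · intro f g h
    exact (ae_eq_restrict_iff_indicator_ae_eq hS).1 h
  · exact fun f g _ _ => .of_forall fun x => congrFun (Set.indicator_add _ _ _) x
  · exact fun c f _ => .of_forall fun x => congrFun (Set.indicator_const_smul S c f) x
  · exact fun f hf => (aestronglyMeasurable_indicator_iff hS).2 hf.1
  · intro f hf
    simp [enorm_indicator_eq_indicator_enorm, lintegral_indicator hS]

variable {μ : Measure V} [SigmaFinite μ] {h : V → V → ℂ} {C : ℝ≥0}

/-- By Tonelli the integral over `x` can be done first, and each column of `h` has mass at most `C`.
-/
theorem integrable_kernel_mul (hm : Measurable (Function.uncurry h))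
    (hC : ∀ y, ∫⁻ x, ‖h x y‖ₑ ∂μ ≤ C) {f : V → ℂ} (hf : Integrable f μ) :
    Integrable (fun p : V × V => h p.1 p.2 * f p.2) (μ.prod μ) ∧
      ∫⁻ x, ∫⁻ y, ‖h x y * f y‖ₑ ∂μ ∂μ ≤ C * ∫⁻ x, ‖f x‖ₑ ∂μ := by
  have hmeas : AEStronglyMeasurable (fun p : V × V => h p.1 p.2 * f p.2) (μ.prod μ) :=
    hm.aestronglyMeasurable.mul hf.1.comp_snd
  have hb : ∫⁻ x, ∫⁻ y, ‖h x y * f y‖ₑ ∂μ ∂μ ≤ C * ∫⁻ x, ‖f x‖ₑ ∂μ := by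
    rw [lintegral_lintegral_swap hmeas.enorm, ← lintegral_const_mul' _ _ ENNReal.coe_ne_top]
    refine lintegral_mono fun y => ?_
    simp only [enorm_mul]
    rw [lintegral_mul_const _ (hm.of_uncurry_right).enorm]
    gcongr
    exact hC y
  refine ⟨⟨hmeas, ?_⟩, hb⟩
  rw [HasFiniteIntegral, lintegral_prod _ hmeas.enorm]
  exact hb.trans_lt (ENNReal.mul_lt_top ENNReal.coe_lt_top hf.2)

theorem ae_integrable_kernel_mul (hm : Measurable (Function.uncurry h))
    (hC : ∀ y, ∫⁻ x, ‖h x y‖ₑ ∂μ ≤ C) {f : V → ℂ} (hf : Integrable f μ) :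
    ∀ᵐ x ∂μ, Integrable (fun y => h x y * f y) μ :=
  (integrable_kernel_mul hm hC hf).1.prod_right_ae

theorem exists_clm_kernel (hm : Measurable (Function.uncurry h))
    (hC : ∀ y, ∫⁻ x, ‖h x y‖ₑ ∂μ ≤ C) :
    ∃ T : Lp ℂ 1 μ →L[ℂ] Lp ℂ 1 μ,
      ∀ f : Lp ℂ 1 μ, T f =ᵐ[μ] fun x => ∫ y, h x y * f y ∂μ := by
  refine exists_clm_of_formula (fun f x => ∫ y, h x y * f y ∂μ) C ?_ ?_ ?_ ?_ ?_
  · intro f g hfg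
    refine .of_forall fun x => integral_congr_ae ?_
    filter_upwards [hfg] with y hy
    rw [hy]
  · intro f g hf hg
    filter_upwards [ae_integrable_kernel_mul hm hC hf, ae_integrable_kernel_mul hm hC hg]
      with x h₁ h₂
    simp only [Pi.add_apply, mul_add]
    exact integral_add h₁ h₂
  · intro c f _
    refine .of_forall fun x => ?_
    simp only [Pi.smul_apply, smul_eq_mul, mul_left_comm _ c]
    exact integral_const_mul _ _
  · intro f hf
    exact (integrable_kernel_mul hm hC hf).1.1.integral_prod_right'
  · intro f hf
    exact (lintegral_mono fun x => enorm_integral_le_lintegral_enorm _).trans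
      (integrable_kernel_mul hm hC hf).2

end Construction

/-! ### Elimination of the complementary component -/

section SchurComplement

variable {X Y : Type*} [NormedAddCommGroup X] [NormedSpace ℂ X] [NormedAddCommGroup Y]
  [NormedSpace ℂ Y] {D H L G A : X →L[ℂ] X} {R : Y →L[ℂ] Y} {ι : Y →L[ℂ] X} {ρ : X →L[ℂ] Y}
  {lam : ℂ}

/-- Elimination of the complementary component: `ι` and `ρ` are the inclusion of and the projection
onto the retained component, `L` inverts `lam - D` on the complementary one and `G` inverts
`1 - L H (1 - ι ρ)`. -/
theorem schur_iff
    (hA : ∀ u, A u = D u + H u)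
    (hR : ∀ v, R v = ρ (D (ι v) + H (ι v) + H (G (L (H (ι v))))))
    (hρι : ∀ v, ρ (ι v) = v)
    (hLD : ∀ u, L (lam • u - D u) = u - ι (ρ u))
    (hDL : ∀ u, lam • L u - D (L u) = u - ι (ρ u))
    (hDρ : ∀ u, ι (ρ (D u)) = D (ι (ρ u)))
    (hG : ∀ u, G (u - L (H (u - ι (ρ u)))) = u)
    (hG' : ∀ u, G u - L (H (G u - ι (ρ (G u)))) = u) (u g : X) :
    lam • u - A u = g ↔ u = ι (ρ u) + G (L (g + H (ι (ρ u)))) ∧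
      lam • ρ u - R (ρ u) = ρ (g + H (G (L g))) := by
  obtain ⟨v, hv⟩ : ∃ v, v = ρ u := ⟨_, rfl⟩
  rw [← hv]
  have hDι : ρ (D (ι v)) = ρ (D u) := by
    rw [hv, ← hDρ, hρι]
  constructor
  · intro hg
    have hg' : lam • u - D u = g + H u := by rw [← hg, hA]; abel
    -- Applying `L` to `(lam - D) u = g + H u` isolates the complementary part `u - ι v`, which `ρ`
    -- kills; `hG` then solves for it.
    have h1 : u - ι v - L (H ((u - ι v) - ι (ρ (u - ι v)))) = L (g + H (ι v)) := by
      have := hLD u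
      rw [hg', ← hv] at this
      rw [map_sub ρ, hρι, ← hv, sub_self, map_zero, sub_zero, map_sub H, map_sub L, ← this,
        map_add, map_add]
      abel
    have h2 : u - ι v = G (L (g + H (ι v))) := by rw [← h1, hG]
    refine ⟨by rw [← h2]; abel, ?_⟩
    have h3 : H u = H (ι v) + H (G (L g)) + H (G (L (H (ι v)))) := by
      have : u = ι v + G (L (g + H (ι v))) := by rw [← h2]; abel
      conv_lhs => rw [this]
      simp only [map_add]
      abel
    have h4 := congrArg ρ hg'
    rw [h3] at h4
    simp only [map_add, map_sub, map_smul] at h4 ⊢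
    rw [hR]
    simp only [map_add]
    rw [hDι, hv, ← sub_sub, ← sub_sub, h4, hv]
    abel
  · rintro ⟨h1, h2⟩
    obtain ⟨w, hw⟩ : ∃ w, w = G (L (g + H (ι v))) := ⟨_, rfl⟩
    rw [← hw] at h1
    -- Since `ρ w = 0`, the projection in `hG'` drops out and the equation becomes `w = L (g + H
    -- u)`.
    have hρw : ρ w = 0 := by
      have := congrArg ρ h1
      rw [map_add, hρι, ← hv] at this
      simpa using this
    have hw1 : w = L (g + H u) := by
      have := hG' (L (g + H (ι v)))
      rw [← hw, hρw, map_zero, sub_zero] at this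
      rw [h1, map_add H, ← add_assoc, map_add L, ← this]
      abel
    have hw2 : lam • w - D w = (g + H u) - ι (ρ (g + H u)) := by
      rw [hw1, hDL]
    have hv2 : lam • ι v - D (ι v) = ι (ρ (g + H u)) := by
      have e1 : D (ι v) = ι (ρ (D (ι v))) := by rw [hDρ, hρι]
      rw [e1, ← map_smul, ← map_sub]
      congr 1
      have e2 : H u = H (ι v) + H (G (L g)) + H (G (L (H (ι v)))) := by
        conv_lhs => rw [h1, hw]
        simp only [map_add]
        abel
      rw [hR, sub_eq_iff_eq_add] at h2
      rw [h2, e2]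
      simp only [map_add]
      abel
    have : lam • u - D u = g + H u := by
      calc lam • u - D u = (lam • ι v - D (ι v)) + (lam • w - D w) := by
            conv_lhs => rw [h1]
            simp only [map_add, smul_add]
            abel
        _ = g + H u := by rw [hw2, hv2]; abel
    rw [hA, ← sub_sub, this]
    abel

end SchurComplement

/-! ### Gronwall inequality along an exhaustion -/

section Gronwall

variable {V : Type*} [MeasurableSpace V] {μ : Measure V}

theorem one_add_le_ofReal_exp_toReal {a : ℝ≥0∞} (ha : a ≠ ∞) :
    1 + a ≤ ENNReal.ofReal (Real.exp a.toReal) := by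
  rw [← ENNReal.ofReal_toReal ha, ← ENNReal.ofReal_one,
    ← ENNReal.ofReal_add zero_le_one ENNReal.toReal_nonneg, ENNReal.ofReal_toReal ha, add_comm]
  exact ENNReal.ofReal_le_ofReal (Real.add_one_le_exp _)

/-- A Gronwall inequality along an exhaustion by increasing sets. -/
theorem lintegral_le_exp_mul_of_levels {E : ℕ → Set V} (hE : ∀ k, MeasurableSet (E k))
    (hmono : Monotone E) (huniv : ⋃ k, E k = Set.univ) {F P m : V → ℝ≥0∞}
    (hF : AEMeasurable F μ) (hm : AEMeasurable m μ) (hmfin : ∫⁻ x, m x ∂μ ≠ ∞)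
    (h0 : ∀ᵐ x ∂μ, x ∈ E 0 → P x ≤ F x)
    (hs : ∀ k, ∀ᵐ x ∂μ, x ∈ E (k + 1) \ E k → P x ≤ F x + m x * ∫⁻ y in E k, P y ∂μ) :
    ∫⁻ x, P x ∂μ ≤ ENNReal.ofReal (Real.exp (∫⁻ x, m x ∂μ).toReal) * ∫⁻ x, F x ∂μ := by
  have hfin : ∀ s : Set V, ∫⁻ x in s, m x ∂μ ≠ ∞ := fun s =>
    ((setLIntegral_le_lintegral s _).trans_lt hmfin.lt_top).ne
  have key : ∀ k, ∫⁻ x in E k, P x ∂μ ≤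
      ENNReal.ofReal (Real.exp (∫⁻ x in E k, m x ∂μ).toReal) * ∫⁻ x in E k, F x ∂μ := by
    intro k
    induction k with
    | zero =>
      refine (setLIntegral_mono_ae' (hE 0) h0).trans ?_
      refine le_mul_of_one_le_left zero_le ?_
      rw [ENNReal.one_le_ofReal]
      exact Real.one_le_exp ENNReal.toReal_nonneg
    | succ k ih =>
      have hsplit : ∀ f : V → ℝ≥0∞, ∫⁻ x in E (k + 1), f x ∂μ =
          ∫⁻ x in E k, f x ∂μ + ∫⁻ x in E (k + 1) \ E k, f x ∂μ := fun f => by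
        rw [← lintegral_inter_add_sdiff f (E (k + 1)) (hE k),
          Set.inter_eq_right.2 (hmono k.le_succ)]
      have hd := (hE (k + 1)).diff (hE k)
      set a := ∫⁻ x in E k, m x ∂μ
      set b := ∫⁻ x in E (k + 1) \ E k, m x ∂μ
      set U := ∫⁻ x in E k, P x ∂μ
      set Φ := ∫⁻ x in E k, F x ∂μ
      set Ψ := ∫⁻ x in E (k + 1) \ E k, F x ∂μ
      -- The new shell is controlled by the integral over `E k` alone, so nothing is absorbed and
      -- `P` need not be integrable in advance. The step costs a factor `1 + b ≤ exp b`, and the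
      -- exponents add up to the integral of `m`.
      have h1 : ∫⁻ x in E (k + 1) \ E k, P x ∂μ ≤ Ψ + b * U := by
        refine (setLIntegral_mono_ae' hd (hs k)).trans ?_
        rw [lintegral_add_left' hF.restrict, lintegral_mul_const'' _ hm.restrict]
      have hexp : ENNReal.ofReal (Real.exp (a + b).toReal) =
          ENNReal.ofReal (Real.exp b.toReal) * ENNReal.ofReal (Real.exp a.toReal) := by
        rw [← ENNReal.ofReal_mul (Real.exp_nonneg _), ← Real.exp_add,
          ENNReal.toReal_add (hfin _) (hfin _), add_comm]
      have hone : 1 ≤ ENNReal.ofReal (Real.exp (a + b).toReal) := by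
        rw [ENNReal.one_le_ofReal]
        exact Real.one_le_exp ENNReal.toReal_nonneg
      rw [hsplit, hsplit, hsplit]
      calc U + ∫⁻ x in E (k + 1) \ E k, P x ∂μ ≤ U + (Ψ + b * U) := by gcongr
        _ = (1 + b) * U + Ψ := by ring
        _ ≤ ENNReal.ofReal (Real.exp b.toReal) * (ENNReal.ofReal (Real.exp a.toReal) * Φ)
            + ENNReal.ofReal (Real.exp (a + b).toReal) * Ψ := by
          gcongr
          · exact one_add_le_ofReal_exp_toReal (hfin _)
          · exact le_mul_of_one_le_left zero_le hone
        _ = ENNReal.ofReal (Real.exp (a + b).toReal) * (Φ + Ψ) := by rw [hexp]; ring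
  rw [← setLIntegral_univ P, ← huniv, setLIntegral_iUnion_of_directed _ hmono.directed_le]
  refine iSup_le fun k => (key k).trans ?_
  gcongr
  · exact Measure.restrict_le_self
  · exact Measure.restrict_le_self

end Gronwall

/-! ### Depth sets and kernel estimates on them -/

section Depth

theorem setIter_subset_setIter_succ {V : Type*} (F : V → Set V) {x y : V} (hy : y ∈ F x) (n : ℕ) :
    setIter F n y ⊆ setIter F (n + 1) x := by
  induction n with
  | zero =>
    rintro z rfl
    simpa [setIter] using hy
  | succ n ih => exact Set.biUnion_subset_biUnion_left ih

theorem one_le_exitTime {V : Type*} {supp : V → Set V} {S : Set V} {x : V}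
    (hx : ∃ n, setIter (phi supp S) n x = ∅) : 1 ≤ exitTime supp S x := by
  refine Nat.one_le_iff_ne_zero.2 fun h0 => ?_
  have : setIter (phi supp S) (exitTime supp S x) x = ∅ := Nat.sInf_mem hx
  rw [h0] at this
  exact Set.singleton_ne_empty x this

variable {V : Type*} [MeasurableSpace V]

theorem subset_depthSet (K : ComplexKernel V) (S : Set V) (n : ℕ) : S ⊆ depthSet K S n := by
  induction n with
  | zero => exact subset_rfl
  | succ n ih => exact ih.trans Set.subset_union_right

theorem monotone_depthSet (K : ComplexKernel V) (S : Set V) : Monotone (depthSet K S) :=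
  monotone_nat_of_le_succ fun _ => Set.subset_union_right

/-- If the iterate `n + 1` at `x` is empty, so is the iterate `n` at each `y` in `phi supp S x`. By
induction all of `supp x` lies in the depth set `n`, and `K_x` is carried by `supp x`. -/
theorem mem_depthSet_of_setIter_eq_empty (K : ComplexKernel V) {S : Set V} {supp : V → Set V}
    (hsupp : ∀ x, (K.meas x).variation (supp x)ᶜ = 0) (n : ℕ) (x : V)
    (hx : setIter (phi supp S) n x = ∅) : x ∈ depthSet K S n := by
  induction n generalizing x with
  | zero => exact absurd hx (Set.singleton_ne_empty x)
  | succ n ih =>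
    refine Or.inl (measure_mono_null (Set.compl_subset_compl.2 fun y hy => ?_) (hsupp x))
    by_cases hyS : y ∈ S
    · exact subset_depthSet K S n hyS
    · exact ih y (Set.subset_empty_iff.1
        ((setIter_subset_setIter_succ (phi supp S) ⟨hyS, hy⟩ n).trans hx.subset))

theorem iUnion_depthSet {K : ComplexKernel V} {μ : Measure V} {S : Set V}
    (hSB : IsStructuralB K μ S) : ⋃ n, depthSet K S n = Set.univ := by
  obtain ⟨-, supp, hsupp, M, -, hexit, -⟩ := hSB
  refine Set.eq_univ_of_forall fun x => Set.mem_iUnion.2 ?_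
  by_cases hx : x ∈ S
  · exact ⟨0, hx⟩
  · obtain ⟨n, hn⟩ := hexit x hx
    exact ⟨n, mem_depthSet_of_setIter_eq_empty K hsupp n x hn⟩

/-- The family `h` is a density of the kernel `K` with respect to `μ`. -/
def IsDensity (K : ComplexKernel V) (μ : Measure V) (h : V → V → ℂ) : Prop :=
  Measurable (Function.uncurry h) ∧
    ∀ x, Integrable (h x) μ ∧ K.meas x = μ.withDensityᵥ (h x)

theorem ComplexKernel.IsOneInftyBounded.exists_isDensity {K : ComplexKernel V} {μ : Measure V}
    (hK : K.IsOneInftyBounded μ) :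
    ∃ h, IsDensity K μ h ∧ ∃ C : ℝ≥0, ∀ y, ∫⁻ x, ‖h x y‖ₑ ∂μ ≤ C := by
  obtain ⟨h, hm, hC, hh⟩ := hK
  exact ⟨h, ⟨hm, fun x => ⟨(hh x).1, VectorMeasure.ext fun B hB => by
    rw [(hh x).2 B hB, withDensityᵥ_apply (hh x).1 hB]⟩⟩, hC⟩

variable {K : ComplexKernel V} {μ : Measure V} {h : V → V → ℂ} {S : Set V}

theorem IsDensity.cintegral_eq (hh : IsDensity K μ h) (x : V) (f : V → ℂ) {s : Set V}
    (hs : MeasurableSet s) : cintegral (K.meas x) s f = ∫ y in s, h x y * f y ∂μ := by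
  rw [(hh.2 x).2, cintegral_withDensityᵥ (hh.2 x).1 _ hs]

theorem IsDensity.integrableOn_iff (hh : IsDensity K μ h) (x : V) (f : V → ℂ) {s : Set V}
    (hs : MeasurableSet s) :
    (K.meas x).IntegrableOn f s ↔ IntegrableOn (fun y => h x y * f y) s μ := by
  rw [(hh.2 x).2, integrableOn_withDensityᵥ_iff (hh.2 x).1 hs]

theorem IsDensity.variation_eq (hh : IsDensity K μ h) (x : V) :
    (K.meas x).variation = μ.withDensity fun y => ‖h x y‖ₑ := by
  rw [(hh.2 x).2, Measure.variation_withDensityᵥ (hh.2 x).1]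

theorem IsDensity.variation_absolutelyContinuous (hh : IsDensity K μ h) (x : V) :
    (K.meas x).variation ≪ μ := by
  rw [hh.variation_eq]
  exact withDensity_absolutelyContinuous _ _

theorem IsDensity.ae_eq_zero (hh : IsDensity K μ h) {x : V} {s : Set V} (hs : MeasurableSet s)
    (hx : (K.meas x).variation s = 0) : ∀ᵐ y ∂μ, y ∈ s → h x y = 0 := by
  rw [hh.variation_eq, withDensity_apply _ hs,
    setLIntegral_eq_zero_iff hs (hh.1.of_uncurry_left).enorm] at hx
  filter_upwards [hx] with y hy hys
  simpa using hy hys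

/-- The set added at each stage is the zero set of `x ↦ ∫ |h(x, y)| dy` over the complement of the
previous one, measurable because `h` is jointly measurable. -/
theorem IsDensity.measurableSet_depthSet [SFinite μ] (hh : IsDensity K μ h)
    (hS : MeasurableSet S) (n : ℕ) : MeasurableSet (depthSet K S n) := by
  induction n with
  | zero => exact hS
  | succ n ih =>
    refine MeasurableSet.union ?_ ih
    have : Measurable fun x => ∫⁻ y in (depthSet K S n)ᶜ, ‖h x y‖ₑ ∂μ :=
      Measurable.lintegral_prod_right' (f := fun p : V × V => ‖h p.1 p.2‖ₑ) hh.1.enorm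
    convert! this (measurableSet_singleton 0) using 1
    ext x
    simp [hh.variation_eq, withDensity_apply _ ih.compl]

/-- The variation is the least measure dominating `‖K_x(B)‖`, so the setwise bound by `M μ` passes
to `|h(x, ·)| μ` on `Sᶜ`. -/
theorem IsDensity.lintegral_mul_le (hh : IsDensity K μ h) (hS : MeasurableSet S) {x : V}
    {M : ℝ≥0} (hM : ∀ B : Set V, MeasurableSet B → B ⊆ Sᶜ → ‖K.meas x B‖ₑ ≤ M * μ B)
    {f : V → ℝ≥0∞} (hf : AEMeasurable f μ) :
    ∫⁻ y in Sᶜ, ‖h x y‖ₑ * f y ∂μ ≤ M * ∫⁻ y in Sᶜ, f y ∂μ := by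
  have hle : (K.meas x).variation.restrict Sᶜ ≤ (M : ℝ≥0∞) • μ.restrict Sᶜ := by
    rw [← VectorMeasure.variation_restrict hS.compl]
    refine VectorMeasure.variation_le_of_forall_enorm_le fun B hB => ?_
    rw [VectorMeasure.restrict_apply _ hS.compl hB, Measure.smul_apply,
      Measure.restrict_apply hB, smul_eq_mul]
    exact hM _ (hB.inter hS.compl) Set.inter_subset_right
  rw [hh.variation_eq, restrict_withDensity hS.compl] at hle
  have hm : Measurable fun y => ‖h x y‖ₑ := (hh.1.of_uncurry_left).enorm
  calc ∫⁻ y in Sᶜ, ‖h x y‖ₑ * f y ∂μ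
      = ∫⁻ y, f y ∂(μ.restrict Sᶜ).withDensity fun y => ‖h x y‖ₑ :=
        (lintegral_withDensity_eq_lintegral_mul₀ hm.aemeasurable hf.restrict).symm
    _ ≤ ∫⁻ y, f y ∂((M : ℝ≥0∞) • μ.restrict Sᶜ) := lintegral_mono' hle le_rfl
    _ = M * ∫⁻ y in Sᶜ, f y ∂μ := by rw [lintegral_smul_measure, smul_eq_mul]

/-- This is the source of the Gronwall hypothesis: `h x` vanishes almost everywhere off the depth
set, so only values of `f` on that set contribute. -/
theorem IsDensity.enorm_integral_le_of_mem_depthSet [SFinite μ] (hh : IsDensity K μ h)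
    (hS : MeasurableSet S) {x : V} {M : ℝ≥0}
    (hM : ∀ B : Set V, MeasurableSet B → B ⊆ Sᶜ → ‖K.meas x B‖ₑ ≤ M * μ B) {n : ℕ}
    (hx : (K.meas x).variation (depthSet K S n)ᶜ = 0) {f : V → ℂ}
    (hf : AEStronglyMeasurable f μ) :
    ‖∫ y in Sᶜ, h x y * f y ∂μ‖ₑ ≤ M * ∫⁻ y in depthSet K S n, ‖f y‖ₑ ∂μ := by
  have hE := hh.measurableSet_depthSet hS n
  refine (enorm_integral_le_lintegral_enorm _).trans ?_
  have h1 : ∫⁻ y in Sᶜ, ‖h x y * f y‖ₑ ∂μ =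
      ∫⁻ y in Sᶜ, ‖h x y‖ₑ * (depthSet K S n).indicator (fun y => ‖f y‖ₑ) y ∂μ := by
    refine lintegral_congr_ae (ae_restrict_of_ae ?_)
    filter_upwards [hh.ae_eq_zero hE.compl hx] with y hy
    by_cases hyE : y ∈ depthSet K S n
    · simp [hyE]
    · simp [hy hyE]
  rw [h1]
  refine (hh.lintegral_mul_le hS hM (hf.enorm.indicator hE)).trans ?_
  exact mul_le_mul_right
    ((setLIntegral_le_lintegral _ _).trans (lintegral_indicator hE _).le) _

end Depth

/-! ### Convergence of the Neumann series -/

section Neumann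

/-- Summability of each orbit suffices. The series gives surjectivity of `1 - N`; a vector fixed by
`N` has a constant orbit tending to 0, hence is 0; the open mapping theorem makes the inverse
bounded. -/
theorem exists_inverse_of_tsum_ne_top {X : Type*} [NormedAddCommGroup X] [NormedSpace ℂ X]
    [CompleteSpace X] {N : X →L[ℂ] X} (hN : ∀ f, ∑' n, ‖(N ^ n) f‖ₑ ≠ ∞) :
    ∃ G : X →L[ℂ] X, (∀ f, G (f - N f) = f) ∧ (∀ f, G f - N (G f) = f) ∧
      ∀ f, G f = ∑' n, (N ^ n) f := by
  have hsum : ∀ f, Summable fun n => (N ^ n) f := fun f => Summable.of_enorm (hN f)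
  have hstep : ∀ f, N (∑' n, (N ^ n) f) = ∑' n, (N ^ (n + 1)) f := fun f => by
    rw [N.map_tsum (hsum f)]
    simp only [pow_succ', mul_apply_eq_comp]
  have hright : ∀ f, (∑' n, (N ^ n) f) - N (∑' n, (N ^ n) f) = f := fun f => by
    rw [hstep, (hsum f).tsum_eq_zero_add]
    simp
  have hbij : Function.Bijective (1 - N : X →L[ℂ] X) := by
    refine ⟨(injective_iff_map_eq_zero _).2 fun f hf => ?_, fun f => ⟨_, hright f⟩⟩
    have hNf : N f = f := (sub_eq_zero.1 (by simpa using hf)).symm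
    have hpow : ∀ n, (N ^ n) f = f := fun n => by
      induction n with
      | zero => simp
      | succ n ih => rw [pow_succ, mul_apply_eq_comp, hNf, ih]
    have := (hsum f).tendsto_atTop_zero
    simp only [hpow] at this
    exact tendsto_const_nhds_iff.1 this
  obtain ⟨U, hU⟩ := ContinuousLinearMap.isUnit_iff_bijective.2 hbij
  have h1 : ∀ f, (↑U⁻¹ : X →L[ℂ] X) (f - N f) = f := fun f => by
    have := congrArg (fun T : X →L[ℂ] X => T f) U.inv_mul
    simpa [hU] using this
  refine ⟨↑U⁻¹, h1, fun f => ?_, fun f => ?_⟩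
  · have := congrArg (fun T : X →L[ℂ] X => T f) U.mul_inv
    simpa only [hU, mul_apply_eq_comp, sub_apply, one_apply_eq_self] using this
  · conv_lhs => rw [← hright f]
    exact h1 _

variable {V : Type*} [MeasurableSpace V] {K : ComplexKernel V} {μ : Measure V} [SigmaFinite μ]
  {h : V → V → ℂ} {S : Set V}

theorem IsDensity.tsum_enorm_pow_ne_top (hh : IsDensity K μ h) (hS : MeasurableSet S)
    (hSB : IsStructuralB K μ S) {ell : V → ℂ} {e : ℝ≥0} (hell : ∀ x, ‖ell x‖ₑ ≤ e)
    (hell0 : ∀ x ∈ S, ell x = 0) {N : Lp ℂ 1 μ →L[ℂ] Lp ℂ 1 μ}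
    (hN : ∀ f : Lp ℂ 1 μ, N f =ᵐ[μ] fun x => ell x * ∫ y in Sᶜ, h x y * f y ∂μ)
    (f : Lp ℂ 1 μ) : ∑' n, ‖(N ^ n) f‖ₑ ≠ ∞ := by
  have huniv := iUnion_depthSet hSB
  obtain ⟨-, supp, -, M, hMm, hexit, hM, hint⟩ := hSB
  set m : V → ℝ≥0∞ := fun x => e * Sᶜ.indicator (fun x => (M x : ℝ≥0∞)) x with hmdef
  have hMm' : Measurable fun x => (M x : ℝ≥0∞) := hMm.coe_nnreal_ennreal
  have hm : Measurable m := (hMm'.indicator hS.compl).const_mul _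
  have hmfin : ∫⁻ x, m x ∂μ ≠ ∞ := by
    rw [lintegral_const_mul _ (hMm'.indicator hS.compl), lintegral_indicator hS.compl]
    -- As `n_S ≥ 1` on `Sᶜ`, the weighted integrability condition gives `∫ M < ∞` there.
    refine ENNReal.mul_ne_top ENNReal.coe_ne_top (ne_top_of_le_ne_top hint.ne ?_)
    refine setLIntegral_mono' hS.compl fun x hx => le_mul_of_one_le_left zero_le ?_
    exact_mod_cast one_le_exitTime (hexit x hx)
  have hsucc : ∀ n, (N ^ (n + 1)) f = N ((N ^ n) f) := fun n => by
    rw [pow_succ', mul_apply_eq_comp]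
  have hrec : ∀ᵐ x ∂μ, ∀ n,
      (N ^ (n + 1)) f x = ell x * ∫ y in Sᶜ, h x y * (N ^ n) f y ∂μ :=
    ae_all_iff.2 fun n => by rw [hsucc]; exact hN _
  have hme : ∀ n, AEMeasurable (fun x => ‖(N ^ n) f x‖ₑ) μ := fun n =>
    (Lp.aestronglyMeasurable _).enorm
  have hnorm : ∀ g : Lp ℂ 1 μ, ‖g‖ₑ = ∫⁻ x, ‖g x‖ₑ ∂μ := fun g => by
    rw [Lp.enorm_def, eLpNorm_one_eq_lintegral_enorm]
  have hgron := lintegral_le_exp_mul_of_levels (μ := μ) (E := depthSet K S)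
    (F := fun x => ‖f x‖ₑ) (P := fun x => ∑' n, ‖(N ^ n) f x‖ₑ) (m := m)
    (hh.measurableSet_depthSet hS) (monotone_depthSet K S) huniv
    (Lp.aestronglyMeasurable f).enorm hm.aemeasurable hmfin ?_ ?_
  · simp only [hnorm]
    rw [← lintegral_tsum hme]
    refine ne_top_of_le_ne_top (ENNReal.mul_ne_top ENNReal.ofReal_ne_top ?_) hgron
    rw [← hnorm]
    exact enorm_ne_top
  -- On `S` the factor `ell` vanishes, so only the term `n = 0` of the series survives.
  · filter_upwards [hrec] with x hx hxS
    rw [tsum_eq_zero_add' ENNReal.summable]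
    simp only [hx, hell0 x hxS, zero_mul, enorm_zero, tsum_zero, add_zero]
    simp
  · intro k
    filter_upwards [hrec] with x hx hxk
    have hxS : x ∈ Sᶜ := fun hxS => hxk.2 (subset_depthSet K S k hxS)
    have hxv : (K.meas x).variation (depthSet K S k)ᶜ = 0 := hxk.1.resolve_right hxk.2
    rw [tsum_eq_zero_add' ENNReal.summable, lintegral_tsum fun n => (hme n).restrict,
      ← ENNReal.tsum_mul_left]
    refine add_le_add (by simp) (ENNReal.tsum_le_tsum fun n => ?_)
    rw [hx, enorm_mul, hmdef]
    simp only [Set.indicator_of_mem hxS]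
    rw [mul_assoc]
    exact mul_le_mul' (hell x) (hh.enorm_integral_le_of_mem_depthSet hS (hM x hxS) hxv
      (Lp.aestronglyMeasurable _))

end Neumann

/-! ### Identification of the reduced operator and the depth recursion -/

section Reduction

variable {V : Type*} [MeasurableSpace V]

theorem operatorOf_eq {ν : Measure V} {F : (V → ℂ) → V → ℂ} {T : Lp ℂ 1 ν →L[ℂ] Lp ℂ 1 ν}
    (hT : Represents ν F T) : operatorOf ν F = T := by
  have hex : ∃ T, Represents ν F T := ⟨T, hT⟩
  rw [operatorOf, dif_pos hex]
  exact hex.choose_spec.unique hT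

/-- The complement of `Σ_d` is open, so `lam` has a positive distance `r` from `d(Sᶜ)`, and `r⁻¹` is
the bound. -/
theorem exists_enorm_inv_le {V : Type*} {d : V → ℂ} {S : Set V} {lam : ℂ} (hlam : lam ∉ sigmaD d S) :
    ∃ e : ℝ≥0, ∀ x, ‖Sᶜ.indicator (fun x => (lam - d x)⁻¹) x‖ₑ ≤ e := by
  obtain ⟨r, hr, hball⟩ := Metric.isOpen_iff.1 isClosed_closure.isOpen_compl lam hlam
  refine ⟨Real.toNNReal r⁻¹, fun x => ?_⟩
  by_cases hx : x ∈ S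
  · simp [hx]
  · have hdist : r ≤ ‖lam - d x‖ := by
      rw [← dist_eq_norm, dist_comm]
      by_contra! hlt
      exact hball hlt (subset_closure ⟨x, hx, rfl⟩)
    rw [Set.indicator_of_mem (show x ∈ Sᶜ from hx), enorm_eq_nnnorm, ENNReal.coe_le_coe,
      ← NNReal.coe_le_coe, coe_nnnorm, norm_inv, Real.coe_toNNReal _ (by positivity)]
    exact inv_anti₀ hr hdist

theorem sub_ne_zero_of_notMem_sigmaD {V : Type*} {d : V → ℂ} {S : Set V} {lam : ℂ}
    (hlam : lam ∉ sigmaD d S) {x : V} (hx : x ∉ S) : lam - d x ≠ 0 := by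
  intro h0
  rw [sub_eq_zero.1 h0] at hlam
  exact hlam (subset_closure ⟨x, hx, rfl⟩)

variable {K : ComplexKernel V} {μ : Measure V} {h : V → V → ℂ} {S : Set V}

/-- The recursion expresses values at depth `n + 1` through those at depth at most `n`. Exceptional
sets do no harm: `μ`-null sets are null for every `K_x`. No measurability of the solutions is
needed. -/
theorem DepthRecursion.ae_eq (hh : IsDensity K μ h) (huniv : ⋃ n, depthSet K S n = Set.univ)
    {d : V → ℂ} {lam : ℂ} {v u w : V → ℂ} (hu : DepthRecursion K d μ S lam v u)
    (hw : DepthRecursion K d μ S lam v w) : w =ᵐ[μ] u := by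
  have key : ∀ n, ∀ᵐ x ∂μ, x ∈ depthSet K S n → w x = u x := by
    intro n
    induction n with
    | zero =>
      filter_upwards [hu.1, hw.1] with x h₁ h₂ hx
      rw [h₁ hx, h₂ hx]
    | succ n ih =>
      filter_upwards [ih, hu.2 n, hw.2 n] with x h₀ h₁ h₂ hx
      by_cases hxn : x ∈ depthSet K S n
      · exact h₀ hxn
      · rw [h₁ ⟨hx, hxn⟩, h₂ ⟨hx, hxn⟩]
        refine VectorMeasure.setIntegral_congr_ae ?_
        filter_upwards [(hh.variation_absolutelyContinuous x).ae_le ih] with y hy hys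
        rw [hy hys]
  filter_upwards [ae_all_iff.2 key] with x hx
  obtain ⟨n, hn⟩ := Set.mem_iUnion.1 (huniv.symm.subset (Set.mem_univ x))
  exact hx n hn

theorem restrict_extendByZero {ι : Lp ℂ 1 (μ.restrict S) →L[ℂ] Lp ℂ 1 μ} (hS : MeasurableSet S)
    (hι : ∀ f : Lp ℂ 1 (μ.restrict S), ι f =ᵐ[μ] S.indicator f) (f : Lp ℂ 1 (μ.restrict S)) :
    LpToLpRestrictCLM V ℂ ℂ μ 1 S (ι f) = f :=
  Lp.ext (((LpToLpRestrictCLM_coeFn ℂ S (ι f)).trans (ae_restrict_of_ae (hι f))).trans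
    (indicator_ae_eq_restrict hS))

theorem extendByZero_restrict {ι : Lp ℂ 1 (μ.restrict S) →L[ℂ] Lp ℂ 1 μ} (hS : MeasurableSet S)
    (hι : ∀ f : Lp ℂ 1 (μ.restrict S), ι f =ᵐ[μ] S.indicator f) (f : Lp ℂ 1 μ) :
    ι (LpToLpRestrictCLM V ℂ ℂ μ 1 S f) =ᵐ[μ] S.indicator f :=
  (hι _).trans ((ae_eq_restrict_iff_indicator_ae_eq hS).1 (LpToLpRestrictCLM_coeFn ℂ S f))

theorem integral_mul_indicator (hS : MeasurableSet S) (g f : V → ℂ) :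
    ∫ y, g y * S.indicator f y ∂μ = ∫ y in S, g y * f y ∂μ := by
  rw [← integral_indicator hS]
  congr 1 with y
  by_cases hy : y ∈ S <;> simp [hy]

variable {d : V → ℂ} {lam : ℂ}
  {D H : Lp ℂ 1 μ →L[ℂ] Lp ℂ 1 μ} {ι : Lp ℂ 1 (μ.restrict S) →L[ℂ] Lp ℂ 1 μ}

theorem represents_formulaA (hh : IsDensity K μ h)
    (hD : ∀ f : Lp ℂ 1 μ, D f =ᵐ[μ] fun x => d x * f x)
    (hH : ∀ f : Lp ℂ 1 μ, H f =ᵐ[μ] fun x => ∫ y, h x y * f y ∂μ) :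
    Represents μ (formulaA K d) (D + H) := fun f => by
  filter_upwards [Lp.coeFn_add (D f) (H f), hD f, hH f] with x h₁ h₂ h₃
  rw [add_apply, h₁, Pi.add_apply, h₂, h₃, formulaA,
    hh.cintegral_eq x _ MeasurableSet.univ, setIntegral_univ]

/-- Each integration over `Sᶜ` with weight `1 / (lam - d)` is one application of `H L`, so the terms
of `R_S(lam)` are `H` applied to the terms of the Neumann series for `G L H ι f`, after the initial
`H ι f`. -/
theorem reducedTerm_ae (hh : IsDensity K μ h) (hS : MeasurableSet S)
    (hH : ∀ f : Lp ℂ 1 μ, H f =ᵐ[μ] fun x => ∫ y, h x y * f y ∂μ)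
    (hι : ∀ f : Lp ℂ 1 (μ.restrict S), ι f =ᵐ[μ] S.indicator f)
    {ρ : Lp ℂ 1 μ →L[ℂ] Lp ℂ 1 (μ.restrict S)} {L N : Lp ℂ 1 μ →L[ℂ] Lp ℂ 1 μ}
    (hL : ∀ f : Lp ℂ 1 μ, L f =ᵐ[μ] fun x => Sᶜ.indicator (fun x => (lam - d x)⁻¹) x * f x)
    (hN : ∀ u, N u = L (H (u - ι (ρ u)))) (hρL : ∀ u, ρ (L u) = 0)
    (f : Lp ℂ 1 (μ.restrict S)) :
    reducedTerm K d S lam f 0 =ᵐ[μ] H (ι f) ∧ ∀ n,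
      (∀ x, (fun y => h x y * (N ^ n) (L (H (ι f))) y) =ᵐ[μ]
        Sᶜ.indicator fun y => h x y * (reducedTerm K d S lam f n y / (lam - d y))) ∧
      reducedTerm K d S lam f (n + 1) =ᵐ[μ] H ((N ^ n) (L (H (ι f)))) := by
  have h0 : reducedTerm K d S lam f 0 =ᵐ[μ] H (ι f) := by
    filter_upwards [hH (ι f)] with x hx
    rw [reducedTerm, hh.cintegral_eq x _ hS, hx, ← integral_mul_indicator hS]
    refine integral_congr_ae ?_
    filter_upwards [hι f] with y hy
    rw [hy]
  have hind : ∀ n (p : Lp ℂ 1 μ), (p =ᵐ[μ] fun x =>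
      Sᶜ.indicator (fun x => (lam - d x)⁻¹) x * reducedTerm K d S lam f n x) → ∀ x,
      (fun y => h x y * p y) =ᵐ[μ]
        Sᶜ.indicator fun y => h x y * (reducedTerm K d S lam f n y / (lam - d y)) := by
    intro n p hp x
    filter_upwards [hp] with y hy
    rw [hy]
    by_cases hyS : y ∈ S
    · simp [hyS]
    · simp [hyS, div_eq_inv_mul]
  have hsucc : ∀ n (p : Lp ℂ 1 μ), (p =ᵐ[μ] fun x =>
      Sᶜ.indicator (fun x => (lam - d x)⁻¹) x * reducedTerm K d S lam f n x) →
      reducedTerm K d S lam f (n + 1) =ᵐ[μ] H p := by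
    intro n p hp
    filter_upwards [hH p] with x hx
    rw [hx, reducedTerm, hh.cintegral_eq x _ hS.compl, ← integral_indicator hS.compl]
    exact integral_congr_ae (hind n p hp x).symm
  have key : ∀ n, ρ ((N ^ n) (L (H (ι f)))) = 0 ∧ (N ^ n) (L (H (ι f))) =ᵐ[μ] fun x =>
      Sᶜ.indicator (fun x => (lam - d x)⁻¹) x * reducedTerm K d S lam f n x := by
    intro n
    induction n with
    | zero =>
      refine ⟨hρL _, ?_⟩
      rw [pow_zero, one_apply_eq_self]
      filter_upwards [hL (H (ι f)), h0] with x h₁ h₂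
      rw [h₁, h₂]
    | succ n ih =>
      -- The iterates vanish on `S`, so the projection inside `N` acts trivially and `N` reduces to
      -- `L H`.
      have hs : (N ^ (n + 1)) (L (H (ι f))) = L (H ((N ^ n) (L (H (ι f))))) := by
        rw [pow_succ', mul_apply_eq_comp, hN, ih.1, map_zero, sub_zero]
      rw [hs]
      refine ⟨hρL _, ?_⟩
      filter_upwards [hL (H ((N ^ n) (L (H (ι f))))), hsucc n _ ih.2] with x h₁ h₂
      rw [h₁, h₂]
  exact ⟨h0, fun n => ⟨hind n _ (key n).2, hsucc n _ (key n).2⟩⟩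

theorem represents_formulaR (hh : IsDensity K μ h) (hS : MeasurableSet S)
    (hD : ∀ f : Lp ℂ 1 μ, D f =ᵐ[μ] fun x => d x * f x)
    (hH : ∀ f : Lp ℂ 1 μ, H f =ᵐ[μ] fun x => ∫ y, h x y * f y ∂μ)
    (hι : ∀ f : Lp ℂ 1 (μ.restrict S), ι f =ᵐ[μ] S.indicator f)
    {ρ : Lp ℂ 1 μ →L[ℂ] Lp ℂ 1 (μ.restrict S)} (hρ : ρ = LpToLpRestrictCLM V ℂ ℂ μ 1 S)
    {L G N : Lp ℂ 1 μ →L[ℂ] Lp ℂ 1 μ}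
    (hL : ∀ f : Lp ℂ 1 μ, L f =ᵐ[μ] fun x => Sᶜ.indicator (fun x => (lam - d x)⁻¹) x * f x)
    (hN : ∀ u, N u = L (H (u - ι (ρ u)))) (hρL : ∀ u, ρ (L u) = 0)
    (hG : ∀ u, G u = ∑' n, (N ^ n) u) (hfin : ∀ u, ∑' n, ‖(N ^ n) u‖ₑ ≠ ∞) :
    Represents (μ.restrict S) (formulaR K d S lam)
      (ρ ∘L (D + H + H ∘L G ∘L L ∘L H) ∘L ι) ∧
    ∀ f : Lp ℂ 1 (μ.restrict S), ∀ᵐ x ∂μ, Summable fun n => ‖reducedTerm K d S lam f n x‖ := by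
  have hsum : ∀ f : Lp ℂ 1 (μ.restrict S), ∀ᵐ x ∂μ,
      HasSum (fun n => reducedTerm K d S lam f n x) (H (ι f) x + H (G (L (H (ι f)))) x) := by
    intro f
    obtain ⟨h0, hs⟩ := reducedTerm_ae hh hS hH hι hL hN hρL f
    have hfinH : ∑' n, ‖H ((N ^ n) (L (H (ι f))))‖ₑ ≠ ∞ := by
      refine ne_top_of_le_ne_top (ENNReal.mul_ne_top (enorm_ne_top (x := H)) (hfin (L (H (ι f)))))
        ?_
      rw [← ENNReal.tsum_mul_left]
      exact ENNReal.tsum_le_tsum fun n => H.le_opENorm _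
    have hHG : ∑' n, H ((N ^ n) (L (H (ι f)))) = H (G (L (H (ι f)))) := by
      rw [hG, H.map_tsum (Summable.of_enorm (hfin _))]
    -- Absolute convergence in the `L¹` norm gives convergence at almost every point to the same
    -- sum; the term `H ι f` with index 0 is then put back in front.
    filter_upwards [h0, ae_all_iff.2 fun n => (hs n).2, Lp.hasSum_coeFn_tsum hfinH]
      with x h₁ h₂ h₃
    rw [hHG] at h₃
    simp only [← h₂, ← h₁] at h₃ ⊢
    rw [add_comm]
    exact (hasSum_nat_add_iff' 1).1 (by simpa using h₃)
  refine ⟨fun f => ?_, fun f => (hsum f).mono fun x hx => hx.summable.norm⟩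
  have hρ' : ∀ g : Lp ℂ 1 μ, ρ g =ᵐ[μ.restrict S] g := fun g => by
    rw [hρ]; exact LpToLpRestrictCLM_coeFn ℂ S _
  have e : (ρ ∘L (D + H + H ∘L G ∘L L ∘L H) ∘L ι) f
      = ρ (D (ι f) + (H (ι f) + H (G (L (H (ι f)))))) := by
    simp [add_assoc]
  rw [e]
  filter_upwards [hρ' (D (ι f) + (H (ι f) + H (G (L (H (ι f)))))),
    ae_restrict_of_ae (hsum f), ae_restrict_of_ae (Lp.coeFn_add (D (ι f)) _),
    ae_restrict_of_ae (Lp.coeFn_add (H (ι f)) (H (G (L (H (ι f)))))),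
    ae_restrict_of_ae (hD (ι f)), ae_restrict_of_ae (hι f), ae_restrict_mem hS]
    with x h₁ h₂ h₃ h₄ h₅ h₆ hx
  rw [h₁, h₃, Pi.add_apply, h₄, Pi.add_apply, h₅, h₆, formulaR, h₂.tsum_eq,
    Set.indicator_of_mem hx]

variable [SigmaFinite μ]

/-- The operators used in the elimination of the complement of `S`. -/
theorem exists_elimination (hh : IsDensity K μ h) (hd : Measurable d) (hS : MeasurableSet S)
    (hSB : IsStructuralB K μ S) (hlam : lam ∉ sigmaD d S)
    (hD : ∀ f : Lp ℂ 1 μ, D f =ᵐ[μ] fun x => d x * f x)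
    (hH : ∀ f : Lp ℂ 1 μ, H f =ᵐ[μ] fun x => ∫ y, h x y * f y ∂μ)
    (hι : ∀ f : Lp ℂ 1 (μ.restrict S), ι f =ᵐ[μ] S.indicator f)
    {ρ : Lp ℂ 1 μ →L[ℂ] Lp ℂ 1 (μ.restrict S)} (hρ : ρ = LpToLpRestrictCLM V ℂ ℂ μ 1 S) :
    ∃ L G N : Lp ℂ 1 μ →L[ℂ] Lp ℂ 1 μ,
      (∀ f : Lp ℂ 1 μ, L f =ᵐ[μ] fun x => Sᶜ.indicator (fun x => (lam - d x)⁻¹) x * f x) ∧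
      (∀ u, N u = L (H (u - ι (ρ u)))) ∧
      (∀ u, L (lam • u - D u) = u - ι (ρ u)) ∧
      (∀ u, lam • L u - D (L u) = u - ι (ρ u)) ∧
      (∀ u, ρ (L u) = 0) ∧
      (∀ u, ι (ρ (D u)) = D (ι (ρ u))) ∧
      (∀ u, G (u - L (H (u - ι (ρ u)))) = u) ∧
      (∀ u, G u - L (H (G u - ι (ρ (G u)))) = u) ∧
      (∀ u, G u = ∑' n, (N ^ n) u) ∧ ∀ u, ∑' n, ‖(N ^ n) u‖ₑ ≠ ∞ := by
  obtain ⟨e, he⟩ := exists_enorm_inv_le hlam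
  obtain ⟨L, hL⟩ := exists_clm_mul (μ := μ)
    ((measurable_const.sub hd).inv.indicator hS.compl) e he
  have hιρ : ∀ f, ι (ρ f) =ᵐ[μ] S.indicator f := fun f => by
    rw [hρ]; exact extendByZero_restrict hS hι f
  have hQ : ∀ f : Lp ℂ 1 μ, (f - ι (ρ f) : Lp ℂ 1 μ) =ᵐ[μ] Sᶜ.indicator f := fun f => by
    filter_upwards [Lp.coeFn_sub f (ι (ρ f)), hιρ f] with x h₁ h₂
    rw [h₁, Pi.sub_apply, h₂]
    by_cases hx : x ∈ S <;> simp [hx]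
  have hlD : ∀ f : Lp ℂ 1 μ, (lam • f - D f : Lp ℂ 1 μ) =ᵐ[μ] fun x => (lam - d x) * f x :=
    fun f => by
      filter_upwards [Lp.coeFn_sub (lam • f) (D f), Lp.coeFn_smul lam f, hD f] with x h₁ h₂ h₃
      rw [h₁, Pi.sub_apply, h₂, h₃, Pi.smul_apply, smul_eq_mul, sub_mul]
  let N : Lp ℂ 1 μ →L[ℂ] Lp ℂ 1 μ := L ∘L H ∘L (ContinuousLinearMap.id ℂ _ - ι ∘L ρ)
  have hNdef : ∀ u, N u = L (H (u - ι (ρ u))) := fun u => rfl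
  have hN : ∀ f : Lp ℂ 1 μ, N f =ᵐ[μ] fun x =>
      Sᶜ.indicator (fun x => (lam - d x)⁻¹) x * ∫ y in Sᶜ, h x y * f y ∂μ := fun f => by
    filter_upwards [hL (H (f - ι (ρ f))), hH (f - ι (ρ f))] with x h₁ h₂
    rw [hNdef, h₁, h₂, ← integral_mul_indicator hS.compl]
    congr 1
    refine integral_congr_ae ?_
    filter_upwards [hQ f] with y hy
    rw [hy]
  have hfin := hh.tsum_enorm_pow_ne_top hS hSB he (fun x hx => by simp [hx]) hN
  obtain ⟨G, hG, hG', hGs⟩ := exists_inverse_of_tsum_ne_top hfin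
  refine ⟨L, G, N, hL, hNdef, fun u => ?_, fun u => ?_, fun u => ?_, fun u => ?_, hG, hG', hGs,
    hfin⟩
  · refine Lp.ext ?_
    filter_upwards [hL (lam • u - D u), hlD u, hQ u] with x h₁ h₂ h₃
    rw [h₁, h₂, h₃]
    by_cases hx : x ∈ S
    · simp [hx]
    · have := sub_ne_zero_of_notMem_sigmaD hlam hx
      simp [hx, this]
  · refine Lp.ext ?_
    filter_upwards [hlD (L u), hL u, hQ u] with x h₁ h₂ h₃
    rw [h₁, h₂, h₃]
    by_cases hx : x ∈ S
    · simp [hx]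
    · have := sub_ne_zero_of_notMem_sigmaD hlam hx
      simp [hx, this]
  · refine Lp.ext ?_
    have h₁ : ρ (L u) =ᵐ[μ.restrict S] L u := by rw [hρ]; exact LpToLpRestrictCLM_coeFn ℂ S _
    filter_upwards [h₁, ae_restrict_of_ae (hL u), ae_restrict_mem hS,
      Lp.coeFn_zero ℂ 1 (μ.restrict S)] with x h₁ h₂ hx h₃
    rw [h₁, h₂, h₃]
    simp [hx]
  · refine Lp.ext ?_
    filter_upwards [hιρ (D u), hιρ u, hD u, hD (ι (ρ u))] with x h₁ h₂ h₃ h₄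
    rw [h₁, h₄, h₂]
    by_cases hx : x ∈ S <;> simp [hx, h₃]

theorem ae_integrableOn_reducedTerm (hh : IsDensity K μ h) {C : ℝ≥0}
    (hC : ∀ y, ∫⁻ x, ‖h x y‖ₑ ∂μ ≤ C) (hS : MeasurableSet S)
    (hH : ∀ f : Lp ℂ 1 μ, H f =ᵐ[μ] fun x => ∫ y, h x y * f y ∂μ)
    (hι : ∀ f : Lp ℂ 1 (μ.restrict S), ι f =ᵐ[μ] S.indicator f)
    {ρ : Lp ℂ 1 μ →L[ℂ] Lp ℂ 1 (μ.restrict S)} {L N : Lp ℂ 1 μ →L[ℂ] Lp ℂ 1 μ}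
    (hL : ∀ f : Lp ℂ 1 μ, L f =ᵐ[μ] fun x => Sᶜ.indicator (fun x => (lam - d x)⁻¹) x * f x)
    (hN : ∀ u, N u = L (H (u - ι (ρ u)))) (hρL : ∀ u, ρ (L u) = 0)
    (f : Lp ℂ 1 (μ.restrict S)) :
    ∀ᵐ x ∂μ, (K.meas x).IntegrableOn f S ∧
      ∀ n, (K.meas x).IntegrableOn (fun z => reducedTerm K d S lam f n z / (lam - d z)) Sᶜ := by
  have hs := (reducedTerm_ae hh hS hH hι hL hN hρL f).2
  filter_upwards [ae_integrable_kernel_mul hh.1 hC (L1.integrable_coeFn (ι f)),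
    ae_all_iff.2 fun n => ae_integrable_kernel_mul hh.1 hC
      (L1.integrable_coeFn ((N ^ n) (L (H (ι f)))))] with x h₁ h₂
  refine ⟨?_, fun n => ?_⟩
  · rw [hh.integrableOn_iff x _ hS, ← integrable_indicator_iff hS]
    refine h₁.congr ?_
    filter_upwards [hι f] with y hy
    rw [hy]
    by_cases hyS : y ∈ S <;> simp [hyS]
  · rw [hh.integrableOn_iff x _ hS.compl, ← integrable_indicator_iff hS.compl]
    exact (h₂ n).congr ((hs n).1 x)

/-- Off `S` the eigenvalue equation reads `(lam - d) u = ∫ h u`. At depth `n + 1` the integral lives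
on the depth set `n`, and `lam - d ≠ 0`. -/
theorem depthRecursion_of_eigen (hh : IsDensity K μ h) (hS : MeasurableSet S)
    (hlam : lam ∉ sigmaD d S)
    (hD : ∀ f : Lp ℂ 1 μ, D f =ᵐ[μ] fun x => d x * f x)
    (hH : ∀ f : Lp ℂ 1 μ, H f =ᵐ[μ] fun x => ∫ y, h x y * f y ∂μ)
    {u : Lp ℂ 1 μ} (hu : D u + H u = lam • u) :
    DepthRecursion K d μ S lam (LpToLpRestrictCLM V ℂ ℂ μ 1 S u) u := by
  refine ⟨?_, fun n => ?_⟩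
  · rw [← ae_restrict_iff' hS]
    exact (LpToLpRestrictCLM_coeFn ℂ S u).symm
  · have hE := hh.measurableSet_depthSet hS n
    have h0 := Lp.coeFn_add (D u) (H u)
    rw [hu] at h0
    filter_upwards [h0, Lp.coeFn_smul lam u, hD u, hH u] with x h₁ h₂ h₃ h₄ hx
    have hxS : x ∉ S := fun hxS => hx.2 (subset_depthSet K S n hxS)
    have hne := sub_ne_zero_of_notMem_sigmaD hlam hxS
    have hz := hh.ae_eq_zero hE.compl (hx.1.resolve_right hx.2)
    rw [h₂, Pi.add_apply, h₃, h₄, Pi.smul_apply, smul_eq_mul] at h₁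
    have h₅ : ∫ y in depthSet K S n, h x y * u y ∂μ = (lam - d x) * u x := by
      rw [sub_mul, h₁, add_sub_cancel_left]
      refine setIntegral_eq_integral_of_ae_compl_eq_zero ?_
      filter_upwards [hz] with y hy hys
      rw [hy hys, zero_mul]
    rw [hh.cintegral_eq x _ hE]
    simp only [← mul_div_assoc]
    rw [integral_div, h₅, mul_div_cancel_left₀ _ hne]

theorem hasEigenvector_coe_iff {X : Type*} [NormedAddCommGroup X] [NormedSpace ℂ X]
    {T : X →L[ℂ] X} {lam : ℂ} {u : X} :
    Module.End.HasEigenvector (T : X →ₗ[ℂ] X) lam u ↔ T u = lam • u ∧ u ≠ 0 := by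
  rw [Module.End.hasEigenvector_iff, Module.End.mem_eigenspace_iff]
  rfl

end Reduction

end IsospectralReduction

/-! ### Assembly of the theorem -/

theorem mainTheorem1 {V : Type*} [MeasurableSpace V] (μ : Measure V) [SigmaFinite μ]
    (K : ComplexKernel V) (hK : K.IsOneInftyBounded μ)
    (d : V → ℂ) (hd : Measurable d) (hdb : ∃ C : ℝ, ∀ x, ‖d x‖ ≤ C)
    (S : Set V) (hS : MeasurableSet S) (hSB : IsStructuralB K μ S) :
    -- `A` is a well defined bounded operator on `L¹(V)`
    (Represents μ (formulaA K d) (opA K d μ) ∧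
      ∀ f : Lp ℂ 1 μ, ∀ᵐ x ∂μ, (K.meas x).Integrable f) ∧
    -- for `lam ∉ Σ_d`, `R_S(lam)` is a well defined bounded operator on `L¹(S)`
    (∀ lam ∉ sigmaD d S,
      Represents (μ.restrict S) (formulaR K d S lam) (reducedOp K d μ S lam) ∧
      ∀ f : Lp ℂ 1 (μ.restrict S), ∀ᵐ x ∂μ,
        (K.meas x).IntegrableOn f S ∧
        (∀ n, (K.meas x).IntegrableOn (fun z => reducedTerm K d S lam f n z / (lam - d z)) Sᶜ) ∧
        Summable fun n => ‖reducedTerm K d S lam f n x‖) ∧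
    -- (1)
    spectrum ℂ (opA K d μ) \ sigmaD d S ⊆ spReduced K d μ S ∧
    -- (2)
    (∀ lam ∉ sigmaD d S,
      Module.End.HasEigenvalue (opA K d μ : Lp ℂ 1 μ →ₗ[ℂ] Lp ℂ 1 μ) lam ↔
        Module.End.HasEigenvalue (reducedOp K d μ S lam :
          Lp ℂ 1 (μ.restrict S) →ₗ[ℂ] Lp ℂ 1 (μ.restrict S)) lam) ∧
    -- (3)
    (∀ lam ∉ sigmaD d S, ∀ u : Lp ℂ 1 μ,
      Module.End.HasEigenvector (opA K d μ : Lp ℂ 1 μ →ₗ[ℂ] Lp ℂ 1 μ) lam u →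
        Module.End.HasEigenvector (reducedOp K d μ S lam :
          Lp ℂ 1 (μ.restrict S) →ₗ[ℂ] Lp ℂ 1 (μ.restrict S)) lam
          (LpToLpRestrictCLM V ℂ ℂ μ 1 S u)) ∧
    -- (4)
    (∀ lam ∉ sigmaD d S, ∀ v : Lp ℂ 1 (μ.restrict S),
      Module.End.HasEigenvector (reducedOp K d μ S lam :
          Lp ℂ 1 (μ.restrict S) →ₗ[ℂ] Lp ℂ 1 (μ.restrict S)) lam v →
        ∃ u : Lp ℂ 1 μ,
          DepthRecursion K d μ S lam v u ∧
          Module.End.HasEigenvector (opA K d μ : Lp ℂ 1 μ →ₗ[ℂ] Lp ℂ 1 μ) lam u ∧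
          ∀ w : V → ℂ, DepthRecursion K d μ S lam v w → w =ᵐ[μ] u) := by
  obtain ⟨h, hh, C, hC⟩ := hK.exists_isDensity
  obtain ⟨B, hB⟩ := hdb
  obtain ⟨D, hD⟩ := exists_clm_mul (μ := μ) hd B.toNNReal fun x => by
    rw [← ofReal_norm]
    exact ENNReal.ofReal_le_ofReal (hB x)
  obtain ⟨H, hH⟩ := exists_clm_kernel hh.1 hC
  obtain ⟨ι, hι⟩ := exists_clm_extendByZero μ hS
  obtain ⟨ρ, hρ⟩ : ∃ ρ, ρ = LpToLpRestrictCLM V ℂ ℂ μ 1 S := ⟨_, rfl⟩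
  have hrepA := represents_formulaA hh hD hH
  have hA : opA K d μ = D + H := operatorOf_eq hrepA
  have hρι : ∀ v, ρ (ι v) = v := fun v => by rw [hρ]; exact restrict_extendByZero hS hι v
  have main : ∀ lam ∉ sigmaD d S,
      (Represents (μ.restrict S) (formulaR K d S lam) (reducedOp K d μ S lam) ∧
      ∀ f : Lp ℂ 1 (μ.restrict S), ∀ᵐ x ∂μ,
        (K.meas x).IntegrableOn f S ∧
        (∀ n, (K.meas x).IntegrableOn (fun z => reducedTerm K d S lam f n z / (lam - d z)) Sᶜ) ∧
        Summable fun n => ‖reducedTerm K d S lam f n x‖) ∧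
      ∃ L G : Lp ℂ 1 μ →L[ℂ] Lp ℂ 1 μ, (∀ w, ρ (G (L w)) = 0) ∧
        ∀ u g, lam • u - opA K d μ u = g ↔ u = ι (ρ u) + G (L (g + H (ι (ρ u)))) ∧
          lam • ρ u - reducedOp K d μ S lam (ρ u) = ρ (g + H (G (L g))) := by
    intro lam hlam
    obtain ⟨L, G, N, hL, hN, hLD, hDL, hρL, hDρ, hG, hG', hGs, hfin⟩ :=
      exists_elimination hh hd hS hSB hlam hD hH hι hρ
    obtain ⟨hrep, hsum⟩ := represents_formulaR hh hS hD hH hι hρ hL hN hρL hGs hfin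
    have hR : reducedOp K d μ S lam = ρ ∘L (D + H + H ∘L G ∘L L ∘L H) ∘L ι := operatorOf_eq hrep
    refine ⟨⟨hR ▸ hrep, fun f => ?_⟩, L, G, fun w => ?_, fun u g => ?_⟩
    · filter_upwards [ae_integrableOn_reducedTerm hh hC hS hH hι hL hN hρL f, hsum f] with x h₁ h₂
      exact ⟨h₁.1, h₁.2, h₂⟩
    -- The equation for `G` writes `G L w` as `L w` plus another value of `L`, and `ρ` kills the
    -- range of `L`.
    · rw [← sub_add_cancel (G (L w)) (L (H (G (L w) - ι (ρ (G (L w)))))), hG', map_add, hρL, hρL,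
        add_zero]
    · exact schur_iff (fun u => by rw [hA, add_apply])
        (fun v => by rw [hR]; simp) hρι hLD hDL hDρ hG hG' u g
  have hvec : ∀ lam ∉ sigmaD d S, ∀ u : Lp ℂ 1 μ,
      Module.End.HasEigenvector (opA K d μ : Lp ℂ 1 μ →ₗ[ℂ] Lp ℂ 1 μ) lam u →
        Module.End.HasEigenvector (reducedOp K d μ S lam :
          Lp ℂ 1 (μ.restrict S) →ₗ[ℂ] Lp ℂ 1 (μ.restrict S)) lam
          (LpToLpRestrictCLM V ℂ ℂ μ 1 S u) := by
    intro lam hlam u hu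
    obtain ⟨-, L, G, -, hsch⟩ := main lam hlam
    rw [hasEigenvector_coe_iff] at hu
    obtain ⟨h1, h2⟩ := (hsch u 0).1 (by rw [hu.1, sub_self])
    rw [← hρ, hasEigenvector_coe_iff]
    refine ⟨(sub_eq_zero.1 (by simpa using h2)).symm, fun h0 => hu.2 ?_⟩
    rw [h1, h0]
    simp
  have hext : ∀ lam ∉ sigmaD d S, ∀ v : Lp ℂ 1 (μ.restrict S),
      Module.End.HasEigenvector (reducedOp K d μ S lam :
          Lp ℂ 1 (μ.restrict S) →ₗ[ℂ] Lp ℂ 1 (μ.restrict S)) lam v →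
        ∃ u : Lp ℂ 1 μ,
          DepthRecursion K d μ S lam v u ∧
          Module.End.HasEigenvector (opA K d μ : Lp ℂ 1 μ →ₗ[ℂ] Lp ℂ 1 μ) lam u ∧
          ∀ w : V → ℂ, DepthRecursion K d μ S lam v w → w =ᵐ[μ] u := by
    intro lam hlam v hv
    obtain ⟨-, L, G, hρGL, hsch⟩ := main lam hlam
    rw [hasEigenvector_coe_iff] at hv
    -- The only candidate: the first Schur equation with `g = 0` and `ρ u = v`.
    obtain ⟨u, hu⟩ : ∃ u, u = ι v + G (L (0 + H (ι v))) := ⟨_, rfl⟩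
    have hρu : ρ u = v := by rw [hu, map_add, hρι, hρGL, add_zero]
    have hAu : opA K d μ u = lam • u := by
      refine (sub_eq_zero.1 ((hsch u 0).2 ⟨by rw [hρu, ← hu], ?_⟩)).symm
      rw [hρu, hv.1]
      simp
    have hrec : DepthRecursion K d μ S lam v u := by
      rw [← hρu, hρ]
      exact depthRecursion_of_eigen hh hS hlam hD hH (by rw [← add_apply, ← hA, hAu])
    refine ⟨u, hrec, hasEigenvector_coe_iff.2 ⟨hAu, fun h0 => hv.2 ?_⟩,
      fun w hw => hrec.ae_eq hh (iUnion_depthSet hSB) hw⟩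
    rw [← hρu, h0, map_zero]
  refine ⟨⟨hA ▸ hrepA, fun f => ?_⟩, fun lam hlam => (main lam hlam).1, ?_, fun lam hlam => ?_,
    hvec, hext⟩
  · filter_upwards [ae_integrable_kernel_mul hh.1 hC (L1.integrable_coeFn f)] with x hx
    rw [(hh.2 x).2]
    exact (integrable_withDensityᵥ_iff (hh.2 x).1).2 hx
  · rintro lam ⟨hspec, hlam⟩
    refine ⟨hlam, fun hunit => hspec ?_⟩
    obtain ⟨-, L, G, hρGL, hsch⟩ := main lam hlam
    have hb := ContinuousLinearMap.isUnit_iff_bijective.1 hunit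
    refine ContinuousLinearMap.isUnit_iff_bijective.2
      ⟨(injective_iff_map_eq_zero _).2 fun u hu => ?_, fun g => ?_⟩
    · obtain ⟨h1, h2⟩ := (hsch u 0).1 hu
      have h0 : ρ u = 0 := (injective_iff_map_eq_zero _).1 hb.1 _ (by
        rw [sub_apply, smul_apply, one_apply_eq_self, ← neg_sub, h2]
        simp)
      rw [h1, h0]
      simp
    -- The sign appears because `hb` concerns `R - lam` while the Schur equation has `lam - R`.
    · obtain ⟨v, hv⟩ := hb.2 (-ρ (g + H (G (L g))))
      have hρu : ρ (ι v + G (L (g + H (ι v)))) = v := by rw [map_add, hρι, hρGL, add_zero]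
      have hsol := (hsch (ι v + G (L (g + H (ι v)))) g).2 ⟨by rw [hρu], ?_⟩
      · exact ⟨_, hsol⟩
      rw [hρu, ← neg_sub, ← neg_neg (ρ (g + H (G (L g)))), ← hv]
      rfl
  · constructor
    · intro hev
      obtain ⟨u, hu⟩ := hev.exists_hasEigenvector
      exact Module.End.hasEigenvalue_of_hasEigenvector (hvec lam hlam u hu)
    · intro hev
      obtain ⟨v, hv⟩ := hev.exists_hasEigenvector
      obtain ⟨u, -, hu, -⟩ := hext lam hlam v hv
      exact Module.End.hasEigenvalue_of_hasEigenvector hu
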